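/- Conventions. A scwol (small category without loops) $X$ consists of a set of vertices $VX$, a set of edges $EX$, maps $i,t:EX\to VX$ (initial and terminal vertex), and a composition $(a,b)\mapsto ab\in EX$ defined for all pairs of edges with $i(a)=t(b)$, such that $i(ab)=i(b)$, $t(ab)=t(a)$, $(ab)c=a(bc)$ whenever both sides are defined, and $i(a)\ne t(a)$ for all $a\in EX$. A path in $X$ is a finite (possibly empty) sequence of consecutive oriented edges $a$ or $a^{-1}$ ($a\in EX$), where $i(a^{-1})=t(a)$, $t(a^{-1})=i(a)$. Homotopy of paths is the equivalence relation generated by deleting a subpath $(e,e^{-1})$, replacing a subpath $(b,a)$ by $(ab)$, and replacing a subpath $(a^{-1},b^{-1})$ by $((ab)^{-1})$. $X$ is connected if any two vertices are joined by a path, and simply connected if it is connected and every loop is homotopic to the constant path, i.e. its fundamental group is trivial. A complex of groups $\mathbb X=((G_\sigma)_{\sigma\in VX},(\psi_a)_{a\in EX},(g_{a,b}))$ over $X$ consists of groups $G_\sigma$, monomorphisms $\psi_a:G_{i(a)}\to G_{t(a)}$, and elements $g_{a,b}\in G_{t(a)}$ for all $a,b\in EX$ with $i(a)=t(b)$, such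 that $g_{a,b}\,\psi_{ab}(x)\,g_{a,b}^{-1}=\psi_a(\psi_b(x))$ and $\psi_a(g_{b,c})\,g_{a,bc}=g_{a,b}\,g_{ab,c}$. It is developable if it is isomorphic to the complex of groups associated to an action of a group on a scwol (local groups: isotropy groups of representatives $\bar\sigma$ of the vertex orbits; $\psi_a$: conjugation by $h_a$, where $h_a$ maps $t(\bar a)$ to $\overline{t(a)}$ and $\bar a$ is the lift of $a$ with $i(\bar a)=\overline{i(a)}$; $g_{a,b}=h_ah_bh_{ab}^{-1}$). An $\mathbb X$-path from $\sigma$ to $\tau$ is a tuple $p=(g_0,e_1,g_1,\dots,e_k,g_k)$, $k\ge 0$, where $(e_1,\dots,e_k)$ is a path in $X$ from $\sigma$ to $\tau$, $g_0\in G_\sigma$ and $g_j\in G_{t(e_j)}$; concatenation $\star$ multiplies the adjacent group elements. Homotopy of $\mathbb X$-paths is the equivalence relation generated by the following replacements of subpaths: $(kg,a,h)\to(k,a,\psi_a(g)h)$; $(g,a^{-1},hk)\to(g\psi_a(h),a^{-1},k)$; $(g,a,\psi_a(h),a^{-1},k)\to(ghk)$; $(g,b^{-1},h,b,k)\to(g\psi_b(h)k)$;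 $(g,b,1,a,k)\to(g,ab,g_{a,b}^{-1}k)$; $(g,a^{-1},1,b^{-1},k)\to(gg_{a,b},(ab)^{-1},k)$. For $\sigma_0\in VX$ and $\mathbb X$-paths $p,q$ issuing from $\sigma_0$ with the same terminal vertex $t(p)$, write $p\equiv q$ if $q$ is homotopic to $p\star(g)$ for some $g\in G_{t(p)}$, and let $[p\rangle$ be the class of $p$. The universal complex $\tilde X_{\sigma_0}$ is the scwol with vertices the classes $[p\rangle$ of $\mathbb X$-paths $p$ issuing from $\sigma_0$, with edges the triples $([p\rangle,a,[p\star(1,a,1)\rangle)$ with $a\in EX$, $i(a)=t(p)$, going from the first to the third component, and with composition $([p\star(1,b,1)\rangle,a,[p\star(1,b,1,a,1)\rangle)\cdot([p\rangle,b,[p\star(1,b,1)\rangle)=([p\rangle,ab,[p\star(1,ab,1)\rangle)$. Proposition. Let $\mathbb X$ be a developable complex of groups over a connected scwol $X$ and let $\sigma_0\in VX$. Then the universal complex $\tilde X_{\sigma_0}$ is simply connected, i.e. it is connected and its fundamental group is trivial (at every base vertex). -/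

import Mathlib

universe u v w u' v' w'

/-- A small category without loops. The set of edges is given as the family of the sets `E σ τ`
of edges with initial vertex `σ` and terminal vertex `τ`, so that `a` and `b` are composable
exactly if `comp a b` typechecks; `comp a b` is the edge `ab` (first `b`, then `a`). -/
structure Scwol where
  V : Type u
  E : V → V → Type v
  comp : ∀ {σ τ ρ : V}, E τ ρ → E σ τ → E σ ρ
  assoc : ∀ {σ τ ρ υ : V} (a : E ρ υ) (b : E τ ρ) (c : E σ τ),
    comp (comp a b) c = comp a (comp b c)
  no_loops : ∀ σ : V, IsEmpty (E σ σ)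

namespace Scwol

/-- The set of all edges. -/
abbrev Edge (X : Scwol.{u, v}) : Type (max u v) := Σ σ τ : X.V, X.E σ τ

/-- The edges issuing from the vertex `σ`. -/
abbrev Star (X : Scwol.{u, v}) (σ : X.V) : Type (max u v) := Σ τ : X.V, X.E σ τ

/-- (Non-degenerate) morphisms of scwols. -/
structure Hom (X : Scwol.{u, v}) (Y : Scwol.{u', v'}) where
  onV : X.V → Y.V
  onE : ∀ {σ τ : X.V}, X.E σ τ → Y.E (onV σ) (onV τ)
  map_comp : ∀ {σ τ ρ : X.V} (a : X.E τ ρ) (b : X.E σ τ),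
    onE (X.comp a b) = Y.comp (onE a) (onE b)
  star_bijective : ∀ σ : X.V,
    Function.Bijective (fun x : X.Star σ => (⟨onV x.1, onE x.2⟩ : Y.Star (onV σ)))

namespace Hom

/-- The map on the sets of all edges. -/
def onEdge {X : Scwol.{u, v}} {Y : Scwol.{u', v'}} (f : Hom X Y) (e : X.Edge) : Y.Edge :=
  ⟨f.onV e.1, f.onV e.2.1, f.onE e.2.2⟩

/-- An isomorphism of scwols is a morphism that is bijective on vertices and on edges. -/
def IsIso {X : Scwol.{u, v}} {Y : Scwol.{u', v'}} (f : Hom X Y) : Prop :=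
  Function.Bijective f.onV ∧ Function.Bijective f.onEdge

/-- The identity morphism. -/
def id (X : Scwol.{u, v}) : Hom X X where
  onV σ := σ
  onE a := a
  map_comp _ _ := rfl
  star_bijective _ := Function.bijective_id

/-- The composition `g ∘ f`. -/
def comp {X Y Z : Scwol.{u, v}} (g : Hom Y Z) (f : Hom X Y) : Hom X Z where
  onV σ := g.onV (f.onV σ)
  onE a := g.onE (f.onE a)
  map_comp a b := by rw [f.map_comp, g.map_comp]
  star_bijective σ := (g.star_bijective (f.onV σ)).comp (f.star_bijective σ)

/-- The endomorphisms of a scwol form a monoid under composition. -/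
instance (X : Scwol.{u, v}) : Monoid (Hom X X) where
  mul := comp
  one := id X
  mul_assoc _ _ _ := rfl
  one_mul _ := rfl
  mul_one _ := rfl

end Hom

/-- The group `Aut(X)` of automorphisms of a scwol. -/
abbrev Aut (X : Scwol.{u, v}) : Type (max u v) := (Hom X X)ˣ

/-- An action of the group `G` on the scwol `X`: no element maps the initial vertex of an edge
to its terminal vertex, and an element that fixes the initial vertex of an edge fixes
the edge. -/
structure Action (G : Type w) [Group G] (X : Scwol.{u, v}) where
  toAut : G →* X.Aut
  no_inversion : ∀ (g : G) {σ τ : X.V} (_ : X.E σ τ), (toAut g).val.onV σ ≠ τ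
  fix_edge : ∀ (g : G) {σ τ : X.V} (a : X.E σ τ),
    (toAut g).val.onV σ = σ → (toAut g).val.onEdge ⟨σ, τ, a⟩ = ⟨σ, τ, a⟩

namespace Action

variable {G : Type w} [Group G] {X : Scwol.{u, v}} (A : Action G X)

/-- `g · σ` for a vertex `σ`. -/
def actV (g : G) (σ : X.V) : X.V := (A.toAut g).val.onV σ

/-- `g · a` for an edge `a`. -/
def actE (g : G) (a : X.Edge) : X.Edge := (A.toAut g).val.onEdge a

theorem actV_one (σ : X.V) : A.actV 1 σ = σ := by
  unfold actV; rw [map_one]; rfl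

theorem actV_mul (g h : G) (σ : X.V) : A.actV (g * h) σ = A.actV g (A.actV h σ) := by
  unfold actV; rw [map_mul]; rfl

theorem actV_inv_actV (g : G) (σ : X.V) : A.actV g⁻¹ (A.actV g σ) = σ := by
  rw [← actV_mul, inv_mul_cancel, actV_one]

/-- The isotropy subgroup of a vertex. -/
def stabilizer (σ : X.V) : Subgroup G where
  carrier := {g | A.actV g σ = σ}
  one_mem' := A.actV_one σ
  mul_mem' {g h} hg hh := by
    have hg : A.actV g σ = σ := hg
    have hh : A.actV h σ = σ := hh
    change A.actV (g * h) σ = σ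
    rw [actV_mul, hh, hg]
  inv_mem' {g} hg := by
    have hg : A.actV g σ = σ := hg
    change A.actV g⁻¹ σ = σ
    conv_lhs => rw [← hg]
    exact A.actV_inv_actV g σ

/-- `p : X → Y` is a quotient morphism of the action, that is, it identifies `Y` with `G \ X`:
it is surjective, and its fibres on vertices and on edges are the orbits. -/
structure IsQuotient {Y : Scwol.{u, v}} (p : Hom X Y) : Prop where
  surjV : Function.Surjective p.onV
  surjE : Function.Surjective p.onEdge
  fibreV : ∀ σ τ : X.V, p.onV σ = p.onV τ ↔ ∃ g : G, A.actV g σ = τ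
  fibreE : ∀ a b : X.Edge, p.onEdge a = p.onEdge b ↔ ∃ g : G, A.actE g a = b

end Action

end Scwol

/-- A complex of groups over the scwol `X`: local groups `grp σ`, boundary monomorphisms `ψ a`
and twisting elements `tw a b` (written $g_{a,b}$). -/
structure ComplexOfGroups (X : Scwol.{u, v}) where
  grp : X.V → Type w
  [group : ∀ σ, Group (grp σ)]
  ψ : ∀ {σ τ : X.V}, X.E σ τ → grp σ →* grp τ
  ψ_injective : ∀ {σ τ : X.V} (a : X.E σ τ), Function.Injective (ψ a)
  tw : ∀ {σ τ ρ : X.V}, X.E τ ρ → X.E σ τ → grp ρ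
  conj_tw : ∀ {σ τ ρ : X.V} (a : X.E τ ρ) (b : X.E σ τ) (x : grp σ),
    tw a b * ψ (X.comp a b) x * (tw a b)⁻¹ = ψ a (ψ b x)
  cocycle : ∀ {σ τ ρ υ : X.V} (a : X.E ρ υ) (b : X.E τ ρ) (c : X.E σ τ),
    ψ a (tw b c) * tw a (X.comp b c) = tw a b * tw (X.comp a b) c

namespace ComplexOfGroups

attribute [instance] ComplexOfGroups.group

/-- Morphisms of complexes of groups. -/
structure Hom {X : Scwol.{u, v}} {Y : Scwol.{u', v'}} (𝕏 : ComplexOfGroups.{u, v, w} X)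
    (𝕐 : ComplexOfGroups.{u', v', w'} Y) where
  base : Scwol.Hom X Y
  locHom : ∀ σ : X.V, 𝕏.grp σ →* 𝕐.grp (base.onV σ)
  elt : ∀ {σ τ : X.V}, X.E σ τ → 𝕐.grp (base.onV τ)
  conj_elt : ∀ {σ τ : X.V} (a : X.E σ τ) (x : 𝕏.grp σ),
    elt a * 𝕐.ψ (base.onE a) (locHom σ x) * (elt a)⁻¹ = locHom τ (𝕏.ψ a x)
  elt_comp : ∀ {σ τ ρ : X.V} (a : X.E τ ρ) (b : X.E σ τ),
    locHom ρ (𝕏.tw a b) * elt (X.comp a b) =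
      elt a * 𝕐.ψ (base.onE a) (elt b) * 𝕐.tw (base.onE a) (base.onE b)

/-- An isomorphism of complexes of groups: the morphism of scwols is an isomorphism and so are
all local homomorphisms. -/
def Hom.IsIso {X : Scwol.{u, v}} {Y : Scwol.{u', v'}} {𝕏 : ComplexOfGroups.{u, v, w} X}
    {𝕐 : ComplexOfGroups.{u', v', w'} Y} (φ : Hom 𝕏 𝕐) : Prop :=
  φ.base.IsIso ∧ ∀ σ, Function.Bijective (φ.locHom σ)

end ComplexOfGroups

namespace Scwol

/-- The choices from which the complex of groups of an action of `G` on `Z` with quotient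
`p : Z → Y` is built: a vertex `vlift σ` over each vertex `σ` of `Y`, for each edge `a` of `Y`
the (unique) edge `elift a` over `a` that issues from `vlift (i(a))`, and an element `h a` of `G`
that maps the terminal vertex of `elift a` to `vlift (t(a))`. -/
structure Action.Lifts {G : Type w} [Group G] {Z Y : Scwol.{u, v}} (A : Action G Z)
    (p : Hom Z Y) where
  vlift : Y.V → Z.V
  onV_vlift : ∀ σ, p.onV (vlift σ) = σ
  elift : ∀ {σ τ : Y.V}, Y.E σ τ → Z.Star (vlift σ)
  onE_elift : ∀ {σ τ : Y.V} (a : Y.E σ τ), p.onEdge ⟨vlift σ, elift a⟩ = ⟨σ, τ, a⟩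
  h : ∀ {σ τ : Y.V}, Y.E σ τ → G
  h_elift : ∀ {σ τ : Y.V} (a : Y.E σ τ), A.actV (h a) (elift a).1 = vlift τ

namespace Action.Lifts

variable {G : Type w} [Group G] {Z Y : Scwol.{u, v}} {A : Action G Z} {p : Hom Z Y}

theorem conj_mem (L : A.Lifts p) {σ τ : Y.V} (a : Y.E σ τ) {g : G} (hg : g ∈ A.stabilizer (L.vlift σ)) :
    L.h a * g * (L.h a)⁻¹ ∈ A.stabilizer (L.vlift τ) := by
  have hg : A.actV g (L.vlift σ) = L.vlift σ := hg
  have h1 := A.fix_edge g (L.elift a).2 hg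
  have h2 : A.actV g (L.elift a).1 = (L.elift a).1 := congrArg (fun e : Z.Edge => e.2.1) h1
  change A.actV (L.h a * g * (L.h a)⁻¹) (L.vlift τ) = L.vlift τ
  rw [← L.h_elift a, actV_mul, actV_mul, actV_inv_actV, h2]

/-- The composite of edges of `Y` may be computed on edges of `Z`. -/
theorem onEdge_comp {Z Y : Scwol.{u, v}} (p : Hom Z Y) {x y z : Z.V} (a' : Z.E y z) (b' : Z.E x y) {σ τ ρ : Y.V}
    (a : Y.E τ ρ) (b : Y.E σ τ) (ha : p.onEdge ⟨y, z, a'⟩ = ⟨τ, ρ, a⟩)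
    (hb : p.onEdge ⟨x, y, b'⟩ = ⟨σ, τ, b⟩) :
    p.onEdge ⟨x, z, Z.comp a' b'⟩ = ⟨σ, ρ, Y.comp a b⟩ := by
  unfold Hom.onEdge at *
  dsimp only at *
  rw [p.map_comp]
  generalize p.onE a' = a'' at *
  generalize p.onE b' = b'' at *
  generalize p.onV x = x' at *
  generalize p.onV y = y' at *
  generalize p.onV z = z' at *
  cases ha
  cases hb
  rfl

theorem tw_mem (hp : A.IsQuotient p) (L : A.Lifts p) {σ τ ρ : Y.V} (a : Y.E τ ρ) (b : Y.E σ τ) :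
    L.h a * L.h b * (L.h (Y.comp a b))⁻¹ ∈ A.stabilizer (L.vlift ρ) := by
  have key : ∀ y : Z.V, A.actV (L.h b)⁻¹ (L.vlift τ) = y →
      ∃ a' : Z.E y (A.actV (L.h b)⁻¹ (L.elift a).1), p.onEdge ⟨y, _, a'⟩ = ⟨τ, ρ, a⟩ := by
    rintro y rfl
    refine ⟨(A.toAut (L.h b)⁻¹).val.onE (L.elift a).2, ?_⟩
    rw [← L.onE_elift a]
    exact ((hp.fibreE ⟨L.vlift τ, L.elift a⟩ _).2 ⟨(L.h b)⁻¹, rfl⟩).symm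
  obtain ⟨a', ha'⟩ := key (L.elift b).1 (by rw [← L.h_elift b, actV_inv_actV])
  have h1 := onEdge_comp p a' (L.elift b).2 a b ha' (L.onE_elift b)
  have h2 := h1.trans (L.onE_elift (Y.comp a b)).symm
  have h3 := (p.star_bijective (L.vlift σ)).1
    (a₁ := ⟨_, Z.comp a' (L.elift b).2⟩) (a₂ := L.elift (Y.comp a b))
    (eq_of_heq (Sigma.ext_iff.1 h2).2)
  have h4 : A.actV (L.h b)⁻¹ (L.elift a).1 = (L.elift (Y.comp a b)).1 := congrArg Sigma.fst h3
  change A.actV (L.h a * L.h b * (L.h (Y.comp a b))⁻¹) (L.vlift ρ) = L.vlift ρ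
  rw [← L.h_elift (Y.comp a b), actV_mul, actV_inv_actV, ← h4, ← actV_mul, mul_assoc,
    mul_inv_cancel, mul_one, L.h_elift a, h4, L.h_elift]

/-- The complex of groups over `Y = G \ Z` associated to an action of `G` on `Z` (and to a choice
of lifts): the local groups are the isotropy groups of the chosen vertices, `ψ a` is conjugation
by `h a`, and the twisting elements are `h a * h b * (h (ab))⁻¹`. -/
def complexOfGroups (hp : A.IsQuotient p) (L : A.Lifts p) : ComplexOfGroups.{u, v, w} Y where
  grp σ := A.stabilizer (L.vlift σ)
  ψ {σ τ} a :=
    { toFun := fun g => ⟨L.h a * g.1 * (L.h a)⁻¹, L.conj_mem a g.2⟩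
      map_one' := Subtype.ext (by simp)
      map_mul' := fun x y => Subtype.ext (by simp) }
  ψ_injective a x y hxy := Subtype.ext (by
    have h1 := congrArg Subtype.val hxy
    simpa using h1)
  tw a b := ⟨L.h a * L.h b * (L.h (Y.comp a b))⁻¹, tw_mem hp L a b⟩
  conj_tw a b x := Subtype.ext (by simp [mul_assoc])
  cocycle a b c := Subtype.ext (by simp [mul_assoc, Y.assoc])

end Action.Lifts
end Scwol

namespace ComplexOfGroups

/-- A complex of groups is developable if it is isomorphic to the complex of groups associated
to an action of a group on a scwol. -/
def IsDevelopable {X : Scwol.{u, v}} (𝕏 : ComplexOfGroups.{u, v, w} X) : Prop :=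
  ∃ (G : Type (max u v w)) (_ : Group G) (Z Y : Scwol.{max u v w, max u v w})
    (A : Scwol.Action G Z) (p : Scwol.Hom Z Y) (hp : A.IsQuotient p) (L : A.Lifts p)
    (φ : Hom 𝕏 (L.complexOfGroups hp)), φ.IsIso

end ComplexOfGroups

namespace Scwol

/-- Oriented edges from `σ` to `τ`: an edge `a : σ → τ`, or the formal inverse `a⁻¹` of an edge
`a : τ → σ`. -/
inductive OEdge (X : Scwol.{u, v}) (σ τ : X.V) : Type v
  | pos (a : X.E σ τ) : OEdge X σ τ
  | neg (a : X.E τ σ) : OEdge X σ τ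

namespace OEdge

/-- The inverse of an oriented edge. -/
def inv {X : Scwol.{u, v}} {σ τ : X.V} : OEdge X σ τ → OEdge X τ σ
  | pos a => neg a
  | neg a => pos a

end OEdge

/-- Edge paths `(e₁, …, e_k)`, `k ≥ 0`, from `σ` to `τ`. -/
inductive Path (X : Scwol.{u, v}) : X.V → X.V → Type (max u v)
  | nil (σ : X.V) : Path X σ σ
  | cons {σ τ ρ : X.V} (e : OEdge X σ τ) (c : Path X τ ρ) : Path X σ ρ

namespace Path

variable {X : Scwol.{u, v}}

/-- Concatenation of paths. -/
def concat {σ τ ρ : X.V} : Path X σ τ → Path X τ ρ → Path X σ ρ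
  | nil _, d => d
  | cons e c, d => cons e (concat c d)

/-- The moves on subpaths that generate homotopy: cancelling `(e, e⁻¹)`, replacing `(b, a)` by
`(ab)`, and replacing `(a⁻¹, b⁻¹)` by `((ab)⁻¹)`. -/
inductive Move : ∀ {σ τ : X.V}, Path X σ τ → Path X σ τ → Prop
  | cancel {σ τ : X.V} (e : OEdge X σ τ) : Move (cons e (cons e.inv (nil σ))) (nil σ)
  | shortcut {σ τ ρ : X.V} (a : X.E τ ρ) (b : X.E σ τ) :
      Move (cons (.pos b) (cons (.pos a) (nil ρ))) (cons (.pos (X.comp a b)) (nil ρ))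
  | shortcutInv {σ τ ρ : X.V} (a : X.E τ ρ) (b : X.E σ τ) :
      Move (cons (.neg a) (cons (.neg b) (nil σ))) (cons (.neg (X.comp a b)) (nil σ))

/-- A move applied to a subpath. -/
def Step {σ τ : X.V} (c d : Path X σ τ) : Prop :=
  ∃ (σ' τ' : X.V) (l : Path X σ σ') (s s' : Path X σ' τ') (r : Path X τ' τ),
    Move s s' ∧ c = l.concat (s.concat r) ∧ d = l.concat (s'.concat r)

/-- Homotopy of paths: the equivalence relation generated by the moves. -/
def homotopy (X : Scwol.{u, v}) (σ τ : X.V) : Setoid (Path X σ τ) := Relation.EqvGen.setoid Step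

end Path

/-- A scwol is connected if any two vertices are joined by a path. -/
def IsConnected (X : Scwol.{u, v}) : Prop := ∀ σ τ : X.V, Nonempty (Path X σ τ)

/-- The (underlying set of the) fundamental group `π₁(X, σ)`: homotopy classes of loops at `σ`. -/
def FundamentalGroup (X : Scwol.{u, v}) (σ : X.V) : Type (max u v) :=
  Quotient (Path.homotopy X σ σ)

/-- A scwol is simply connected if it is connected and its fundamental group at every vertex
is trivial, that is, consists of one element. -/
def IsSimplyConnected (X : Scwol.{u, v}) : Prop :=
  X.IsConnected ∧ ∀ σ : X.V, Subsingleton (X.FundamentalGroup σ)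

end Scwol

namespace ComplexOfGroups

variable {X : Scwol.{u, v}} (𝕏 : ComplexOfGroups.{u, v, w} X)

/-- `𝕏`-paths `(g₀, e₁, g₁, …, e_k, g_k)`, `k ≥ 0`, from `σ` to `τ`; `nil g` is `(g)` and
`cons g e p` is the path `(g, e, p)`. -/
inductive Path : X.V → X.V → Type (max u v w)
  | nil {σ : X.V} (g : 𝕏.grp σ) : Path σ σ
  | cons {σ τ ρ : X.V} (g : 𝕏.grp σ) (e : X.OEdge σ τ) (p : Path τ ρ) : Path σ ρ

namespace Path

variable {𝕏}

/-- Left translation of the first entry of an `𝕏`-path. -/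
def lmul {σ τ : X.V} (g : 𝕏.grp σ) : Path 𝕏 σ τ → Path 𝕏 σ τ
  | nil k => nil (g * k)
  | cons k e p => cons (g * k) e p

/-- Concatenation: `(…, e_k, g_k) ⋆ (g'₀, e'₁, …) = (…, e_k, g_k g'₀, e'₁, …)`. -/
def concat {σ τ ρ : X.V} : Path 𝕏 σ τ → Path 𝕏 τ ρ → Path 𝕏 σ ρ
  | nil g, q => lmul g q
  | cons g e p, q => cons g e (concat p q)

/-- The moves on subpaths that generate homotopy of `𝕏`-paths: edge slides, reductions and
shortcuts. -/
inductive Move : ∀ {σ τ : X.V}, Path 𝕏 σ τ → Path 𝕏 σ τ → Prop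
  | slidePos {σ τ : X.V} (a : X.E σ τ) (k g : 𝕏.grp σ) (h : 𝕏.grp τ) :
      Move (cons (k * g) (.pos a) (nil h)) (cons k (.pos a) (nil (𝕏.ψ a g * h)))
  | slideNeg {σ τ : X.V} (a : X.E σ τ) (g : 𝕏.grp τ) (h k : 𝕏.grp σ) :
      Move (cons g (.neg a) (nil (h * k))) (cons (g * 𝕏.ψ a h) (.neg a) (nil k))
  | reducePos {σ τ : X.V} (a : X.E σ τ) (g h k : 𝕏.grp σ) :
      Move (cons g (.pos a) (cons (𝕏.ψ a h) (.neg a) (nil k))) (nil (g * h * k))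
  | reduceNeg {σ τ : X.V} (b : X.E σ τ) (g k : 𝕏.grp τ) (h : 𝕏.grp σ) :
      Move (cons g (.neg b) (cons h (.pos b) (nil k))) (nil (g * 𝕏.ψ b h * k))
  | shortcutPos {σ τ ρ : X.V} (a : X.E τ ρ) (b : X.E σ τ) (g : 𝕏.grp σ) (k : 𝕏.grp ρ) :
      Move (cons g (.pos b) (cons 1 (.pos a) (nil k)))
        (cons g (.pos (X.comp a b)) (nil ((𝕏.tw a b)⁻¹ * k)))
  | shortcutNeg {σ τ ρ : X.V} (a : X.E τ ρ) (b : X.E σ τ) (g : 𝕏.grp ρ) (k : 𝕏.grp σ) :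
      Move (cons g (.neg a) (cons 1 (.neg b) (nil k)))
        (cons (g * 𝕏.tw a b) (.neg (X.comp a b)) (nil k))

/-- A move applied to an `𝕏`-subpath. -/
def Step {σ τ : X.V} (p q : Path 𝕏 σ τ) : Prop :=
  ∃ (σ' τ' : X.V) (l : Path 𝕏 σ σ') (s s' : Path 𝕏 σ' τ') (r : Path 𝕏 τ' τ),
    Move s s' ∧ p = l.concat (s.concat r) ∧ q = l.concat (s'.concat r)

/-- Homotopy of `𝕏`-paths: the equivalence relation generated by the moves. -/
def Homotopic {σ τ : X.V} : Path 𝕏 σ τ → Path 𝕏 σ τ → Prop := Relation.EqvGen Step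

theorem Homotopic.symm {σ τ : X.V} {p q : Path 𝕏 σ τ} (h : Homotopic p q) : Homotopic q p :=
  Relation.EqvGen.symm _ _ h

theorem Homotopic.trans {σ τ : X.V} {p q r : Path 𝕏 σ τ} (h : Homotopic p q)
    (h' : Homotopic q r) : Homotopic p r :=
  Relation.EqvGen.trans _ _ _ h h'

theorem lmul_mul {σ τ : X.V} (g h : 𝕏.grp σ) (p : Path 𝕏 σ τ) :
    lmul (g * h) p = lmul g (lmul h p) := by
  cases p <;> simp [lmul, mul_assoc]

theorem lmul_concat {σ τ ρ : X.V} (g : 𝕏.grp σ) (p : Path 𝕏 σ τ) (q : Path 𝕏 τ ρ) :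
    (lmul g p).concat q = lmul g (p.concat q) := by
  cases p with
  | nil k => exact lmul_mul g k q
  | cons k e p => rfl

theorem concat_assoc {σ τ ρ υ : X.V} (p : Path 𝕏 σ τ) (q : Path 𝕏 τ ρ) (r : Path 𝕏 ρ υ) :
    (p.concat q).concat r = p.concat (q.concat r) := by
  induction p with
  | nil g => exact lmul_concat g q r
  | cons g e p ih => simp [concat, ih]

theorem concat_one {σ τ : X.V} (p : Path 𝕏 σ τ) : p.concat (nil 1) = p := by
  induction p with
  | nil g => simp [concat, lmul]
  | cons g e p ih => simp [concat, ih]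

theorem Homotopic.concat_right {σ τ ρ : X.V} {p q : Path 𝕏 σ τ} (h : Homotopic p q)
    (r : Path 𝕏 τ ρ) : Homotopic (p.concat r) (q.concat r) := by
  induction h with
  | rel x y hxy =>
    obtain ⟨σ', τ', l, s, s', t, hm, rfl, rfl⟩ := hxy
    exact .rel _ _ ⟨σ', τ', l, s, s', t.concat r, hm, by simp [concat_assoc],
      by simp [concat_assoc]⟩
  | refl x => exact .refl _
  | symm x y _ ih => exact .symm ih
  | trans x y z _ _ ih1 ih2 => exact .trans ih1 ih2

theorem Move.homotopic {σ τ ρ : X.V} (p : Path 𝕏 σ τ) {s s' : Path 𝕏 τ ρ} (h : Move s s') :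
    Homotopic (p.concat s) (p.concat s') :=
  .rel _ _ ⟨τ, ρ, p, s, s', nil 1, h, by rw [concat_one], by rw [concat_one]⟩

/-- The relation `p ≡ q` if and only if `[q] = [p ⋆ (g)]` for some `g` in the local group at the
terminal vertex, on `𝕏`-paths from `σ` to `τ`. -/
def cosetSetoid (𝕏 : ComplexOfGroups.{u, v, w} X) (σ τ : X.V) : Setoid (Path 𝕏 σ τ) where
  r p q := ∃ g : 𝕏.grp τ, Homotopic q (p.concat (nil g))
  iseqv :=
    { refl := fun p => ⟨1, by rw [concat_one]; exact .refl _⟩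
      symm := by
        rintro p q ⟨g, hg⟩
        refine ⟨g⁻¹, Homotopic.symm ?_⟩
        have h := hg.concat_right (nil g⁻¹)
        rw [concat_assoc] at h
        simpa [concat, lmul, concat_one] using h
      trans := by
        rintro p q r ⟨g, hg⟩ ⟨k, hk⟩
        refine ⟨g * k, Homotopic.trans hk ?_⟩
        have h := hg.concat_right (nil k)
        rw [concat_assoc] at h
        simpa [concat, lmul] using h }

/-- The set of classes `[p⟩` of `𝕏`-paths `p` from `σ` to `τ`. -/
def Coset (𝕏 : ComplexOfGroups.{u, v, w} X) (σ τ : X.V) : Type (max u v w) :=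
  Quotient (cosetSetoid 𝕏 σ τ)

/-- The operation `[p⟩ ↦ [p ⋆ (1, a, 1)⟩`. -/
def Coset.extend {σ τ ρ : X.V} (x : Coset 𝕏 σ τ) (a : X.E τ ρ) : Coset 𝕏 σ ρ :=
  Quotient.map' (s₁ := cosetSetoid 𝕏 σ τ) (s₂ := cosetSetoid 𝕏 σ ρ)
    (fun p => p.concat (cons 1 (.pos a) (nil 1)))
    (by
      rintro p q ⟨g, hg⟩
      refine ⟨𝕏.ψ a g, Homotopic.trans (hg.concat_right _) ?_⟩
      have h := (Move.slidePos (𝕏 := 𝕏) a 1 g 1).homotopic p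
      rw [concat_assoc, concat_assoc]
      simpa [concat, lmul] using h) x

theorem Coset.extend_extend {σ τ ρ υ : X.V} (x : Coset 𝕏 σ τ) (b : X.E τ ρ) (a : X.E ρ υ) :
    (x.extend b).extend a = x.extend (X.comp a b) := by
  induction x using Quotient.inductionOn with
  | h p =>
    refine Quotient.sound (s := cosetSetoid 𝕏 σ υ) ⟨𝕏.tw a b, Homotopic.symm ?_⟩
    have h := ((Move.shortcutPos (𝕏 := 𝕏) a b 1 1).homotopic p).concat_right (nil (𝕏.tw a b))
    rw [concat_assoc, concat_assoc] at h
    rw [concat_assoc, concat_assoc]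
    simpa [concat, lmul] using h

end Path

/-- The universal complex of `𝕏` with respect to `σ₀`. Its vertices are the classes `[p⟩` of
`𝕏`-paths issuing from `σ₀` (recorded with their terminal vertex), its edges from `[p⟩` to `[q⟩`
are the edges `a` of `X` from `t(p)` to `t(q)` with `[q⟩ = [p ⋆ (1, a, 1)⟩`, that is, the triples
`([p⟩, a, [p ⋆ (1, a, 1)⟩)`, and composition is that of `X`. -/
def universalComplex (σ₀ : X.V) : Scwol.{max u v w, v} where
  V := Σ τ : X.V, Path.Coset 𝕏 σ₀ τ
  E x y := {a : X.E x.1 y.1 // x.2.extend a = y.2}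
  comp a b := ⟨X.comp a.1 b.1, by rw [← Path.Coset.extend_extend, b.2, a.2]⟩
  assoc _ _ _ := Subtype.ext (X.assoc _ _ _)
  no_loops x := ⟨fun a => (X.no_loops x.1).false a.1⟩

end ComplexOfGroups

/-! A path in the universal complex is the lift of an `𝕏`-path, and homotopies of `𝕏`-paths were
built into the vertices, so a loop upstairs comes from an `𝕏`-path that is trivial up to a local
group element. To avoid lifting homotopies move by move, homotopy is tested by group-valued cocycles
on edges: sending an edge to its class in the fundamental group is such a cocycle, and its holonomy
along a loop is the class of that loop up to conjugation. Hence trivial holonomy for all cocycles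
forces simple connectivity (`isSimplyConnected_of_holonomy_eq_one`).

Given a cocycle on the universal complex, `transport` multiplies its values along the lift of an
`𝕏`-path, and `Homotopic.transport_eq` shows that the result is a homotopy invariant. By
`exists_transport_eq_holonomy` the holonomy of a loop at the base vertex is the transport of some
`𝕏`-path `q`. Since the loop closes up, `q` is homotopic to a path `(g)` without edges, whose
transport is 1. Connectedness is the lifting of `𝕏`-paths (`nonempty_lift`). -/

namespace Scwol

/-! ### Edge paths of a scwol up to homotopy, and the fundamental group. -/

namespace Path

variable {X : Scwol.{u, v}}

theorem concat_assoc {σ τ ρ υ : X.V} (c : Path X σ τ) (d : Path X τ ρ) (e : Path X ρ υ) :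
    (c.concat d).concat e = c.concat (d.concat e) := by
  induction c with
  | nil => rfl
  | cons f c ih => simp [concat, ih]

theorem concat_nil {σ τ : X.V} (c : Path X σ τ) : c.concat (nil τ) = c := by
  induction c with
  | nil => rfl
  | cons f c ih => simp [concat, ih]

/-- The path traversed backwards. -/
def reverse {σ τ : X.V} : Path X σ τ → Path X τ σ
  | nil σ => nil σ
  | cons (σ := σ) e c => c.reverse.concat (cons e.inv (nil σ))

/-- `c` and `d` are homotopic paths. -/
def Homotopic {σ τ : X.V} (c d : Path X σ τ) : Prop := (homotopy X σ τ).r c d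

theorem Homotopic.refl {σ τ : X.V} (c : Path X σ τ) : Homotopic c c :=
  (homotopy X σ τ).refl c

theorem Homotopic.symm {σ τ : X.V} {c d : Path X σ τ} (h : Homotopic c d) : Homotopic d c :=
  (homotopy X σ τ).symm h

theorem Homotopic.trans {σ τ : X.V} {c d e : Path X σ τ} (h : Homotopic c d)
    (h' : Homotopic d e) : Homotopic c e :=
  (homotopy X σ τ).trans h h'

theorem Homotopic.whisker {σ τ ρ υ : X.V} (l : Path X σ τ) {c d : Path X τ ρ}
    (h : Homotopic c d) (r : Path X ρ υ) :
    Homotopic (l.concat (c.concat r)) (l.concat (d.concat r)) := by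
  induction h with
  | rel c d h =>
    obtain ⟨σ', τ', l', s, s', r', hm, rfl, rfl⟩ := h
    exact .rel _ _ ⟨σ', τ', l.concat l', s, s', r'.concat r, hm, by simp [concat_assoc],
      by simp [concat_assoc]⟩
  | refl c => exact .refl _
  | symm c d _ ih => exact .symm ih
  | trans c d e _ _ ih ih' => exact .trans ih ih'

theorem Homotopic.concat_left {σ τ ρ : X.V} (l : Path X σ τ) {c d : Path X τ ρ}
    (h : Homotopic c d) : Homotopic (l.concat c) (l.concat d) := by
  simpa [concat_nil] using h.whisker l (nil ρ)

theorem Homotopic.concat_right {σ τ ρ : X.V} {c d : Path X σ τ} (h : Homotopic c d)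
    (r : Path X τ ρ) : Homotopic (c.concat r) (d.concat r) :=
  h.whisker (nil σ) r

theorem Move.homotopic {σ τ : X.V} {c d : Path X σ τ} (h : Move c d) : Homotopic c d :=
  .rel _ _ ⟨σ, τ, nil σ, c, d, nil τ, h, by simp [concat, concat_nil],
    by simp [concat, concat_nil]⟩

theorem concat_reverse {σ τ : X.V} (c : Path X σ τ) :
    Homotopic (c.concat c.reverse) (nil σ) := by
  induction c with
  | nil σ => exact .refl _
  | @cons σ τ ρ e c ih =>
    have h := ih.whisker (cons e (nil τ)) (cons e.inv (nil σ))
    rw [concat_assoc] at h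
    exact h.trans (Move.cancel e).homotopic

theorem reverse_concat {σ τ : X.V} (c : Path X σ τ) :
    Homotopic (c.reverse.concat c) (nil τ) := by
  induction c with
  | nil σ => exact .refl _
  | @cons σ τ ρ e c ih =>
    have h : Homotopic (cons e.inv (cons e (nil τ))) (nil τ) := by
      -- `e.inv.inv` reduces to `e` only once the orientation of `e` is known.
      cases e with
      | pos a => exact (Move.cancel (OEdge.neg a)).homotopic
      | neg a => exact (Move.cancel (OEdge.pos a)).homotopic
    have h' := h.whisker c.reverse c
    rw [reverse, concat_assoc]
    exact h'.trans ih

theorem reverse_concat_cancel {σ τ ρ : X.V} (c : Path X σ τ) (d : Path X τ ρ) :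
    Homotopic (c.reverse.concat (c.concat d)) d := by
  rw [← concat_assoc]
  exact c.reverse_concat.concat_right d

/-- Conjugating back by `d` cancels both copies of `d` and its reverse. This transfers triviality of
loops between base vertices. -/
theorem homotopic_nil_of_conj {σ τ : X.V} (d : Path X σ τ) {c : Path X τ τ}
    (h : Homotopic (d.concat (c.concat d.reverse)) (nil σ)) : Homotopic c (nil τ) := by
  have h1 := (reverse_concat_cancel d (c.concat d.reverse)).concat_right d
  have h2 := (d.reverse_concat).concat_left c
  have h3 := h.whisker d.reverse d
  rw [concat_nil, ← concat_assoc] at h2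
  rw [← concat_assoc] at h3
  exact h2.symm.trans (h1.symm.trans (h3.trans d.reverse_concat))

/-- The product along an edge path of a family of group elements indexed by the edges. -/
def holonomy {Γ : Type w} [Group Γ] (l : ∀ {σ τ : X.V}, X.E σ τ → Γ) {σ τ : X.V} :
    Path X σ τ → Γ
  | nil _ => 1
  | cons (.pos a) c => l a * c.holonomy l
  | cons (.neg a) c => (l a)⁻¹ * c.holonomy l

end Path

open _root_.Scwol.Path in
/-- The group structure on the fundamental group, given by concatenation of loops. -/
instance (X : Scwol.{u, v}) (σ : X.V) : Group (X.FundamentalGroup σ) where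
  mul := Quotient.map₂ concat fun _ d h c' _ h' =>
    (Homotopic.concat_right h c').trans (Homotopic.concat_left d h')
  one := Quotient.mk _ (nil σ)
  -- No induction on moves is needed: `c⁻¹ ≃ c⁻¹ d d⁻¹ ≃ c⁻¹ c d⁻¹ ≃ d⁻¹`.
  inv := Quotient.map reverse fun c d h => by
    have h1 := (c.reverse_concat).concat_right d.reverse
    have h2 := (Homotopic.whisker c.reverse h d.reverse)
    have h3 := (d.concat_reverse).concat_left c.reverse
    rw [concat_nil] at h3
    rw [concat_assoc] at h1
    exact h3.symm.trans (h2.symm.trans h1)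
  mul_assoc := by
    rintro ⟨c⟩ ⟨d⟩ ⟨e⟩
    exact congrArg (Quotient.mk _) (concat_assoc c d e)
  one_mul := by
    rintro ⟨c⟩
    rfl
  mul_one := by
    rintro ⟨c⟩
    exact congrArg (Quotient.mk _) (concat_nil c)
  inv_mul_cancel := by
    rintro ⟨c⟩
    exact Quotient.sound c.reverse_concat

/-! ### The tautological cocycle and the holonomy criterion. -/

namespace Path

variable {X : Scwol.{u, v}} {σ₀ : X.V}

/-- The class of the loop that is formed from a path by joining both ends to the base vertex. -/
def loopClass (d : ∀ τ, Path X σ₀ τ) {σ τ : X.V} (c : Path X σ τ) : X.FundamentalGroup σ₀ :=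
  Quotient.mk _ ((d σ).concat (c.concat (d τ).reverse))

theorem loopClass_eq (d : ∀ τ, Path X σ₀ τ) {σ τ : X.V} {c c' : Path X σ τ}
    (h : Homotopic c c') : loopClass d c = loopClass d c' :=
  Quotient.sound (h.whisker _ _)

theorem loopClass_nil (d : ∀ τ, Path X σ₀ τ) (σ : X.V) : loopClass d (nil σ) = 1 :=
  Quotient.sound (d σ).concat_reverse

theorem loopClass_concat (d : ∀ τ, Path X σ₀ τ) {σ τ ρ : X.V} (c : Path X σ τ)
    (c' : Path X τ ρ) : loopClass d (c.concat c') = loopClass d c * loopClass d c' := by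
  refine Quotient.sound (Homotopic.symm ?_)
  have h := (reverse_concat_cancel (d τ) (c'.concat (d ρ).reverse)).concat_left
    ((d σ).concat c)
  simpa [concat_assoc] using h

/-- The connecting paths at intermediate vertices cancel, so multiplying the classes of single edges
recovers the class of the whole path. -/
theorem holonomy_eq_loopClass (d : ∀ τ, Path X σ₀ τ) {σ τ : X.V} (c : Path X σ τ) :
    c.holonomy (fun {_ τ} a => loopClass d (cons (.pos a) (nil τ))) = loopClass d c := by
  induction c with
  | nil σ => exact (loopClass_nil d σ).symm
  | @cons σ τ ρ e c ih =>
    rw [show cons e c = (cons e (nil τ)).concat c from rfl, loopClass_concat, ← ih]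
    cases e with
    | pos a => rfl
    | neg a =>
      refine congrArg (· * _) (inv_eq_of_mul_eq_one_right ?_)
      rw [← loopClass_concat, ← loopClass_nil d]
      exact loopClass_eq d (Move.cancel (OEdge.pos a)).homotopic

end Path

open _root_.Scwol.Path in
/-- A scwol is simply connected if every vertex can be joined to `σ₀` and every group-valued
cocycle on the edges has trivial holonomy along the loops at `σ₀`. -/
theorem isSimplyConnected_of_holonomy_eq_one {X : Scwol.{u, v}} (σ₀ : X.V)
    (hconn : ∀ τ, Nonempty (Path X σ₀ τ))
    (hol : ∀ (Γ : Type (max u v)) [Group Γ] (l : ∀ {σ τ : X.V}, X.E σ τ → Γ),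
      (∀ {σ τ ρ : X.V} (a : X.E τ ρ) (b : X.E σ τ), l (X.comp a b) = l b * l a) →
      ∀ c : Path X σ₀ σ₀, c.holonomy l = 1) :
    X.IsSimplyConnected := by
  have d : ∀ τ, Path X σ₀ τ := fun τ => (hconn τ).some
  have base : ∀ c : Path X σ₀ σ₀, Homotopic c (nil σ₀) := by
    intro c
    -- The cocycle is the tautological one; its cocycle identity is the shortcut move.
    have h := hol (X.FundamentalGroup σ₀)
      (fun {_ τ} a => loopClass d (cons (.pos a) (nil τ)))
      (fun a b => by
        rw [← loopClass_concat]
        exact (loopClass_eq d (Move.shortcut a b).homotopic).symm) c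
    rw [holonomy_eq_loopClass] at h
    -- The chosen path `d σ₀` need not be constant, so the holonomy is only a conjugate of the class
    -- of `c`.
    exact homotopic_nil_of_conj (d σ₀) (Quotient.exact h)
  refine ⟨fun σ τ => ⟨(d σ).reverse.concat (d τ)⟩, fun σ => ⟨?_⟩⟩
  have trivial : ∀ c : Path X σ σ, Homotopic c (nil σ) := fun c =>
    homotopic_nil_of_conj (d σ) (base _)
  rintro ⟨c⟩ ⟨c'⟩
  exact Quotient.sound ((trivial c).trans (trivial c').symm)

end Scwol

/-! ### Classes of `𝕏`-paths under extension by an edge. -/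

namespace ComplexOfGroups

variable {X : Scwol.{u, v}} {𝕏 : ComplexOfGroups.{u, v, w} X} {σ₀ : X.V}

namespace Path

theorem lmul_one {σ τ : X.V} (p : Path 𝕏 σ τ) : lmul 1 p = p := by
  cases p <;> simp [lmul]

theorem one_concat {σ τ : X.V} (p : Path 𝕏 σ τ) : (nil 1).concat p = p :=
  lmul_one p

theorem Homotopic.concat_left {σ τ ρ : X.V} (l : Path 𝕏 σ τ) {p q : Path 𝕏 τ ρ}
    (h : Homotopic p q) : Homotopic (l.concat p) (l.concat q) := by
  induction h with
  | rel x y hxy =>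
    obtain ⟨σ', τ', l', s, s', r, hm, rfl, rfl⟩ := hxy
    exact .rel _ _ ⟨σ', τ', l.concat l', s, s', r, hm, by simp [concat_assoc],
      by simp [concat_assoc]⟩
  | refl x => exact .refl _
  | symm x y _ ih => exact .symm ih
  | trans x y z _ _ ih1 ih2 => exact .trans ih1 ih2

/-- The class `[p⟩`. -/
def coset {σ τ : X.V} (p : Path 𝕏 σ τ) : Coset 𝕏 σ τ := Quotient.mk (cosetSetoid 𝕏 σ τ) p

theorem coset_eq_of_homotopic {σ τ : X.V} {p q : Path 𝕏 σ τ} (h : Homotopic p q) :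
    p.coset = q.coset :=
  Quotient.sound (s := cosetSetoid 𝕏 σ τ) ⟨1, by rw [concat_one]; exact h.symm⟩

theorem coset_concat_nil {σ τ : X.V} (p : Path 𝕏 σ τ) (g : 𝕏.grp τ) :
    (p.concat (nil g)).coset = p.coset :=
  (Quotient.sound (s := cosetSetoid 𝕏 σ τ) ⟨g, .refl _⟩).symm

/-- The class absorbs `h`, and it absorbs `g` because `extend` is well defined on classes. -/
theorem coset_concat_pos {σ τ ρ : X.V} (p : Path 𝕏 σ τ) (g : 𝕏.grp τ) (a : X.E τ ρ)
    (h : 𝕏.grp ρ) : (p.concat (cons g (.pos a) (nil h))).coset = p.coset.extend a := by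
  have h1 : (p.concat (cons g (.pos a) (nil h))).coset =
      ((p.concat (nil g)).concat (cons 1 (.pos a) (nil 1))).coset := by
    rw [← coset_concat_nil ((p.concat (nil g)).concat (cons 1 (.pos a) (nil 1))) h]
    simp [concat_assoc, concat, lmul]
  rw [h1, ← coset_concat_nil p g]
  rfl

theorem extend_coset_concat_neg {σ τ ρ : X.V} (p : Path 𝕏 σ τ) (g : 𝕏.grp τ) (a : X.E ρ τ)
    (h : 𝕏.grp ρ) : (p.concat (cons g (.neg a) (nil h))).coset.extend a = p.coset := by
  rw [← coset_concat_pos _ 1 a 1, ← coset_concat_nil p (g * 𝕏.ψ a h * 1), concat_assoc]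
  have h1 := (Move.reduceNeg (𝕏 := 𝕏) a g 1 h).homotopic p
  simpa [concat, lmul] using coset_eq_of_homotopic h1

theorem homotopic_of_coset_eq {σ τ : X.V} {p q : Path 𝕏 σ τ} (h : p.coset = q.coset) :
    ∃ g : 𝕏.grp τ, Homotopic q (p.concat (nil g)) :=
  Quotient.exact (s := cosetSetoid 𝕏 σ τ) h

/-- If `[x⋆(1, a, 1)⟩ = [p⟩`, then `x` arises from `p` by going backwards along `a`. -/
theorem exists_coset_concat_neg_eq {σ τ ρ : X.V} (p : Path 𝕏 σ τ) (a : X.E ρ τ)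
    {x : Coset 𝕏 σ ρ} (h : x.extend a = p.coset) :
    ∃ g : 𝕏.grp τ, (p.concat (cons g (.neg a) (nil 1))).coset = x := by
  induction x using Quotient.inductionOn with
  | h r =>
    change r.coset.extend a = p.coset at h
    rw [← coset_concat_pos r 1 a 1] at h
    -- Here `r ⋆ (1, a, 1)` is homotopic to `p ⋆ (g)`; appending `a⁻¹` to both and reducing gives
    -- back `r`.
    obtain ⟨g, hg⟩ := homotopic_of_coset_eq h.symm
    refine ⟨g, ?_⟩
    have h1 := hg.concat_right (cons 1 (.neg a) (nil 1))
    have h2 := (Move.reducePos (𝕏 := 𝕏) a 1 1 1).homotopic r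
    rw [concat_assoc] at h1
    simp only [concat_assoc, concat, lmul, mul_one, map_one] at h1 h2
    rw [concat_one] at h2
    exact coset_eq_of_homotopic (h1.symm.trans h2)

/-- The product along the lift to the universal complex, starting at `[p⟩`, of an `𝕏`-path, of
a family of group elements indexed by the edges `([p⟩, a, [p ⋆ (1, a, 1)⟩)`. -/
def transport {Γ : Type w'} [Group Γ] (l : ∀ {σ τ : X.V}, Coset 𝕏 σ₀ σ → X.E σ τ → Γ)
    {σ τ : X.V} : Path 𝕏 σ τ → Path 𝕏 σ₀ σ → Γ
  | nil _, _ => 1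
  | cons g (.pos a) q, p =>
    l p.coset a * q.transport l (p.concat (cons g (.pos a) (nil 1)))
  | cons g (.neg a) q, p =>
    (l (p.concat (cons g (.neg a) (nil 1))).coset a)⁻¹ *
      q.transport l (p.concat (cons g (.neg a) (nil 1)))

/-! ### Homotopy invariance of transport. -/

section transport

variable {Γ : Type w'} [Group Γ] (l : ∀ {σ τ : X.V}, Coset 𝕏 σ₀ σ → X.E σ τ → Γ)

theorem transport_congr {σ τ : X.V} (q : Path 𝕏 σ τ) {p p' : Path 𝕏 σ₀ σ}
    (h : Homotopic p p') : q.transport l p = q.transport l p' := by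
  induction q with
  | nil g => rfl
  | cons g e q ih =>
    have h1 := h.concat_right (cons g e (nil 1))
    cases e with
    | pos a => rw [transport, transport, ih h1, coset_eq_of_homotopic h]
    | neg a => rw [transport, transport, ih h1, coset_eq_of_homotopic h1]

theorem transport_lmul {σ τ : X.V} (g : 𝕏.grp σ) (q : Path 𝕏 σ τ) (p : Path 𝕏 σ₀ σ) :
    (lmul g q).transport l p = q.transport l (p.concat (nil g)) := by
  cases q with
  | nil k => rfl
  | cons k e q =>
    cases e with
    | pos a => simp only [lmul, transport, concat_assoc, concat, coset_concat_nil]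
    | neg a => simp only [lmul, transport, concat_assoc, concat]

theorem transport_concat {σ τ ρ : X.V} (q : Path 𝕏 σ τ) (r : Path 𝕏 τ ρ) (p : Path 𝕏 σ₀ σ) :
    (q.concat r).transport l p = q.transport l p * r.transport l (p.concat q) := by
  induction q with
  | nil g => simp [concat, transport, transport_lmul]
  | cons g e q ih =>
    cases e <;> simp [concat, transport, ih, concat_assoc, lmul_one, mul_assoc]

/-- Each label depends only on an edge and the class at its initial vertex. Slides leave these data
unchanged, reductions cancel a label against its inverse, and shortcuts are the cocycle identity. -/
theorem Move.transport_eq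
    (hl : ∀ {σ τ ρ : X.V} (x : Coset 𝕏 σ₀ σ) (b : X.E σ τ) (a : X.E τ ρ),
      l x (X.comp a b) = l x b * l (x.extend b) a)
    {σ τ : X.V} {s s' : Path 𝕏 σ τ} (h : Move s s') (p : Path 𝕏 σ₀ σ) :
    s.transport l p = s'.transport l p := by
  cases h with
  | slidePos a k g h => rfl
  -- An inverse edge is labelled at its far end, where the slid element `h` is absorbed by the
  -- class.
  | slideNeg a g h k =>
    have h1 := coset_eq_of_homotopic ((Move.slideNeg (𝕏 := 𝕏) a g h 1).homotopic p)
    have h2 := coset_concat_nil (p.concat (cons g (.neg a) (nil 1))) h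
    simp only [concat_assoc, concat, lmul, one_mul, mul_one] at h1 h2
    simp only [transport, ← h1, h2]
  | reducePos a g h k =>
    have h1 := coset_eq_of_homotopic ((Move.reducePos (𝕏 := 𝕏) a g h 1).homotopic p)
    rw [coset_concat_nil] at h1
    simp [transport, concat_assoc, concat, lmul, h1]
  | reduceNeg b g k h => simp [transport]
  | shortcutPos a b g k => simp [transport, hl, coset_concat_pos]
  | shortcutNeg a b g k =>
    have h1 := coset_eq_of_homotopic ((Move.shortcutNeg (𝕏 := 𝕏) a b g 1).homotopic p)
    -- This identifies the middle vertex, so that the cocycle identity applies at the end of the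
    -- path.
    have h2 := extend_coset_concat_neg (p.concat (cons g (.neg a) (nil 1))) 1 b 1
    simp only [concat_assoc, concat, lmul, one_mul] at h1 h2
    simp [transport, hl, concat_assoc, concat, lmul, ← h1, h2]

theorem Homotopic.transport_eq
    (hl : ∀ {σ τ ρ : X.V} (x : Coset 𝕏 σ₀ σ) (b : X.E σ τ) (a : X.E τ ρ),
      l x (X.comp a b) = l x b * l (x.extend b) a)
    {σ τ : X.V} {q q' : Path 𝕏 σ τ} (h : Homotopic q q') (p : Path 𝕏 σ₀ σ) :
    q.transport l p = q'.transport l p := by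
  induction h with
  | rel q q' h =>
    obtain ⟨σ', τ', k, s, s', r, hm, rfl, rfl⟩ := h
    rw [transport_concat, transport_concat, transport_concat, transport_concat,
      -- The remainder `r` is transported from two different but homotopic initial paths.
      hm.transport_eq l hl, transport_congr l r (hm.homotopic _)]
  | refl q => rfl
  | symm q q' _ ih => exact ih.symm
  | trans q q' q'' _ _ ih ih' => exact ih.trans ih'

end transport

/-! ### Lifting between `𝕏`-paths and paths of the universal complex. -/

/-- An `𝕏`-path `q` lifts to a path of the universal complex from `[p⟩` to `[p ⋆ q⟩`. -/
theorem nonempty_lift {σ τ : X.V} (q : Path 𝕏 σ τ) (p : Path 𝕏 σ₀ σ) :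
    Nonempty ((𝕏.universalComplex σ₀).Path ⟨σ, p.coset⟩ ⟨τ, (p.concat q).coset⟩) := by
  induction q with
  | nil g =>
    rw [coset_concat_nil]
    exact ⟨.nil _⟩
  | cons g e q ih =>
    obtain ⟨c⟩ := ih (p.concat (cons g e (nil 1)))
    simp only [concat_assoc, concat, lmul_one] at c
    cases e with
    | pos a => exact ⟨.cons (.pos ⟨a, (coset_concat_pos p g a 1).symm⟩) c⟩
    | neg a => exact ⟨.cons (.neg ⟨a, extend_coset_concat_neg p g a 1⟩) c⟩

/-- Terminal classes often agree only propositionally; this lets a label be computed from the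
initial class and the edge of `X` alone. -/
theorem label_eq {Γ : Type w'}
    (l : ∀ {x y : (𝕏.universalComplex σ₀).V}, (𝕏.universalComplex σ₀).E x y → Γ)
    {σ τ : X.V} (x : Coset 𝕏 σ₀ σ) (a : X.E σ τ) {y : Coset 𝕏 σ₀ τ} (h : x.extend a = y) :
    l (x := ⟨σ, x⟩) (y := ⟨τ, y⟩) ⟨a, h⟩ =
      l (x := ⟨σ, x⟩) (y := ⟨τ, x.extend a⟩) ⟨a, rfl⟩ := by
  subst h
  rfl

/-- Every path of the universal complex that issues from `[p⟩` is the lift of an `𝕏`-path. -/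
theorem exists_transport_eq_holonomy {Γ : Type w'} [Group Γ]
    (l : ∀ {x y : (𝕏.universalComplex σ₀).V}, (𝕏.universalComplex σ₀).E x y → Γ)
    {x y : (𝕏.universalComplex σ₀).V} (c : (𝕏.universalComplex σ₀).Path x y)
    (p : Path 𝕏 σ₀ x.1) (hp : p.coset = x.2) :
    ∃ q : Path 𝕏 x.1 y.1, (p.concat q).coset = y.2 ∧
      c.holonomy l = q.transport
        (fun {σ τ} z a => l (x := ⟨σ, z⟩) (y := ⟨τ, z.extend a⟩) ⟨a, rfl⟩) p := by
  induction c with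
  | nil x => exact ⟨nil 1, by rwa [concat_one], rfl⟩
  | @cons x y z e c ih =>
    obtain ⟨σ, x⟩ := x
    obtain ⟨τ, y⟩ := y
    cases e with
    | pos a =>
      obtain ⟨a, ha⟩ := a
      dsimp only at a ha p hp
      subst hp ha
      obtain ⟨q, h1, h2⟩ := ih (p.concat (cons 1 (.pos a) (nil 1))) (coset_concat_pos p 1 a 1)
      refine ⟨cons 1 (.pos a) q, ?_, ?_⟩
      · simpa [concat_assoc, concat, lmul_one] using h1
      · exact congrArg
          (l (x := ⟨σ, p.coset⟩) (y := ⟨τ, p.coset.extend a⟩) ⟨a, rfl⟩ * ·) h2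
    | neg a =>
      obtain ⟨a, ha⟩ := a
      dsimp only at a ha p hp
      subst hp
      -- Going backwards, `a` alone need not determine the next vertex; the entry `g` selects it.
      -- Going forwards the entry 1 suffices.
      obtain ⟨g, rfl⟩ := exists_coset_concat_neg_eq p a ha
      obtain ⟨q, h1, h2⟩ := ih (p.concat (cons g (.neg a) (nil 1))) rfl
      refine ⟨cons g (.neg a) q, ?_, ?_⟩
      · simpa [concat_assoc, concat, lmul_one] using h1
      · refine (congrArg ((l (x := ⟨τ, _⟩) (y := ⟨σ, p.coset⟩) ⟨a, ha⟩)⁻¹ * ·) h2).trans ?_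
        exact congrArg (·⁻¹ * _) (label_eq l _ a ha)

end Path

end ComplexOfGroups

/-! ### Simple connectivity of the universal complex. -/

open ComplexOfGroups.Path in
theorem mainTheorem4 {X : Scwol.{u, v}} (hX : X.IsConnected) (𝕏 : ComplexOfGroups.{u, v, w} X)
    (h𝕏 : 𝕏.IsDevelopable) (σ₀ : X.V) :
    (𝕏.universalComplex σ₀).IsSimplyConnected := by
  refine Scwol.isSimplyConnected_of_holonomy_eq_one
    (⟨σ₀, coset (nil 1)⟩ : (𝕏.universalComplex σ₀).V) ?_ ?_
  · rintro ⟨τ, y⟩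
    induction y using Quotient.inductionOn with
    | h p =>
      have h := nonempty_lift p (nil (1 : 𝕏.grp σ₀))
      rwa [one_concat] at h
  · intro Γ _ l hl c
    obtain ⟨q, h1, h2⟩ := exists_transport_eq_holonomy l c (nil 1) rfl
    -- The loop ends at the class of `(1)`, so `q` is homotopic to an edge-free path.
    obtain ⟨g, hg⟩ := homotopic_of_coset_eq h1.symm
    rw [one_concat] at hg
    refine h2.trans ((hg.transport_eq _ ?_ (nil 1)).trans rfl)
    intro σ τ ρ x b a
    -- The composite edge in the cocycle identity ends at `(x.extend b).extend a`, not literally at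
    -- `x.extend (X.comp a b)`.
    exact (label_eq l x _ (Coset.extend_extend x b a).symm).symm.trans
      (hl (σ := ⟨σ, x⟩) (τ := ⟨τ, x.extend b⟩) (ρ := ⟨ρ, (x.extend b).extend a⟩)
        ⟨a, rfl⟩ ⟨b, rfl⟩)
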